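/- Let $n\ge 0$, let $x_1<x_2<\dots<x_n$ be real numbers and let $m_1,\dots,m_n>0$. For $z\in\mathbb C$ put $$T_k(z)=\begin{pmatrix}1-\frac z2 m_k & -\frac z2 m_k e^{-2x_k}\\ \frac z2 m_k e^{2x_k} & 1+\frac z2 m_k\end{pmatrix}\quad(1\le k\le n),$$ and let $A_n(z)$ be the first entry of the vector $T_n(z)T_{n-1}(z)\cdots T_1(z)\begin{pmatrix}1\\0\end{pmatrix}$ (so $A_0(z)=1$). Let $\mathbf E=\big[\tfrac12 e^{-|x_i-x_j|}\big]_{i,j=1}^n$ and $\mathbf P=\mathrm{diag}(m_1,\dots,m_n)$. Then there are real numbers $0<\lambda_1<\lambda_2<\dots<\lambda_n$ such that, for all $z\in\mathbb C$, $$A_n(z)=\det(I-z\,\mathbf E\mathbf P)=\prod_{k=1}^n\Big(1-\frac z{\lambda_k}\Big).$$ Moreover, consider the peakon boundary value problem $$(1-D_x^2-z\,m)\psi=0,\qquad \psi(x)\to0\ \text{ as }|x|\to\infty,\qquad m=\sum_{j=1}^n m_j\delta_{x_j},$$ for continuous $\psi:\mathbb R\to\mathbb C$, where the equation is understood in the sense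 of distributions. Its spectrum, that is, the set of all $z\in\mathbb C$ for which it has a solution $\psi\not\equiv0$, is exactly $\{\lambda_1,\dots,\lambda_n\}$, and for each $z=\lambda_k$ the space of solutions is one-dimensional. Thus the spectrum is positive and simple. -/

import Mathlib

open scoped ContDiff Topology

namespace Peakon

/-- The transfer matrix across one peakon at position `x` with mass `m`. -/
noncomputable def transferMatrix (x m : ℝ) (z : ℂ) : Matrix (Fin 2) (Fin 2) ℂ :=
  !![1 - z / 2 * (m : ℂ), -(z / 2) * (m : ℂ) * (Real.exp (-2 * x) : ℂ);
     z / 2 * (m : ℂ) * (Real.exp (2 * x) : ℂ), 1 + z / 2 * (m : ℂ)]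

/-- The ordered product `T_n(z) * ⋯ * T_1(z)` of the transfer matrices: the matrix of the
peakon with the smallest index is the rightmost factor. -/
noncomputable def transferProduct {n : ℕ} (x m : Fin n → ℝ) (z : ℂ) :
    Matrix (Fin 2) (Fin 2) ℂ :=
  (List.ofFn fun k : Fin n => transferMatrix (x k) (m k) z).reverse.prod

/-- `A_n(z)`: the coefficient of `e^x` to the right of all peakons of the solution which
equals `e^x` to the left of all of them, i.e. the first entry of
`T_n(z) ⋯ T_1(z) (1, 0)ᵀ`. -/
noncomputable def coeffA {n : ℕ} (x m : Fin n → ℝ) (z : ℂ) : ℂ :=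
  (transferProduct x m z).mulVec ![1, 0] 0

/-- The matrix `E = [e^{-|x_i - x_j|} / 2]`. -/
noncomputable def greenMatrix {n : ℕ} (x : Fin n → ℝ) : Matrix (Fin n) (Fin n) ℝ :=
  Matrix.of fun i j => 1 / 2 * Real.exp (-|x i - x j|)

/-- The matrix `P = diag(m_1, …, m_n)`. -/
def massMatrix {n : ℕ} (m : Fin n → ℝ) : Matrix (Fin n) (Fin n) ℝ :=
  Matrix.diagonal m

/-- The discrete measure `∑ m_j δ_{x_j}` (for nonnegative masses `m_j`). -/
noncomputable def peakonMeasure {n : ℕ} (x m : Fin n → ℝ) : MeasureTheory.Measure ℝ :=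
  ∑ j, ENNReal.ofReal (m j) • MeasureTheory.Measure.dirac (x j)

/-- `ψ` solves the boundary value problem `(1 - D² - z M) ψ = 0`, `ψ → 0` as `|x| → ∞`,
where `M = ∑ m_j δ_{x_j}`: `ψ` is continuous, and the equation holds in the sense of
distributions, i.e. against all smooth compactly supported test functions. -/
structure IsSolution {n : ℕ} (x m : Fin n → ℝ) (z : ℂ) (ψ : ℝ → ℂ) : Prop where
  continuous : Continuous ψ
  tendsto_atBot : Filter.Tendsto ψ Filter.atBot (𝓝 0)
  tendsto_atTop : Filter.Tendsto ψ Filter.atTop (𝓝 0)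
  equation : ∀ φ : ℝ → ℂ, ContDiff ℝ ∞ φ → HasCompactSupport φ →
    ∫ y, ψ y * (φ y - deriv (deriv φ) y) = z * ∫ y, ψ y * φ y ∂(peakonMeasure x m)

/-- The spectrum of the boundary value problem: all complex `z` for which it has a
solution that is not identically zero. -/
def bvpSpectrum {n : ℕ} (x m : Fin n → ℝ) : Set ℂ :=
  {z | ∃ ψ : ℝ → ℂ, IsSolution x m z ψ ∧ ψ ≠ 0}

/-- `z` is a simple eigenvalue: the space of solutions is spanned by one nonzero solution. -/
def IsSimpleEigenvalue {n : ℕ} (x m : Fin n → ℝ) (z : ℂ) : Prop :=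
  ∃ ψ : ℝ → ℂ, IsSolution x m z ψ ∧ ψ ≠ 0 ∧
    ∀ χ : ℝ → ℂ, IsSolution x m z χ → ∃ c : ℂ, χ = c • ψ

end Peakon

namespace Peakon

open Matrix

/-! Everything is read off from the decomposition `E P = V + u vᵀ`, with `V` strictly lower
triangular and `u i = e^{x_i}`. Marching from left to right, the solution starting as `e^x` has site
values `w` with `(1 - z V) w = u`, and `A_n = 1 - z vᵀ w`. Since `det (1 - z V) = 1`, the matrix
determinant lemma turns this into `det (1 - z E P)` (`coeffA_eq_det`), and the same splitting forces
every kernel vector of `1 - z E P` to be a multiple of `w` (`exists_span_kernel`).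

The matrix `P^{1/2} E P^{1/2}` is positive definite, because `E` is a rescaled `min` kernel. Its
eigenvalues are therefore positive, the kernel bound makes them distinct, and their reciprocals are
the `λ_k` (`exists_factorization`).

Finally, `1 - D²` is injective on decaying continuous functions, so the boundary value problem is
equivalent to `ψ = z G(Mψ)` (`isSolution_iff`). A solution is then determined by its site values,
which are exactly the kernel vectors of `1 - z E P`. -/

/-! ### Transfer matrices, the determinant and the kernel. -/

/-- The strictly lower triangular part of `E P` after removal of the rank one matrix
`e^{x_i - x_j} m_j / 2`. -/
noncomputable def volterraMatrix {n : ℕ} (x m : Fin n → ℝ) : Matrix (Fin n) (Fin n) ℂ :=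
  Matrix.of fun i j => if j < i then
    1 / 2 * (Complex.exp (x j) * Complex.exp (-x i) - Complex.exp (x i) * Complex.exp (-x j)) * m j
    else 0

lemma transferProduct_succ {n : ℕ} (x m : Fin (n + 1) → ℝ) (z : ℂ) :
    transferProduct x m z = transferMatrix (x (Fin.last n)) (m (Fin.last n)) z *
      transferProduct (fun i : Fin n => x i.castSucc) (fun i : Fin n => m i.castSucc) z := by
  rw [transferProduct, List.ofFn_succ']
  simp [transferProduct]

/-- The values at the sites `x_i` of the solution that equals `e^x` on the far left, together
with its coefficients on the far right. -/
lemma exists_transfer_values {n : ℕ} (x m : Fin n → ℝ) (z : ℂ) :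
    ∃ w : Fin n → ℂ,
      (∀ i, w i = Complex.exp (x i) + z * ∑ j, volterraMatrix x m i j * w j) ∧
      transferProduct x m z *ᵥ ![1, 0] =
        ![1 - z * ∑ j, 1 / 2 * Complex.exp (-x j) * m j * w j,
          z * ∑ j, 1 / 2 * Complex.exp (x j) * m j * w j] := by
  induction n with
  | zero => exact ⟨0, fun i => i.elim0, by simp [transferProduct]⟩
  | succ n ih =>
    obtain ⟨w, hw, hT⟩ := ih (fun i => x i.castSucc) (fun i => m i.castSucc)
    set a := 1 - z * ∑ j : Fin n,
      1 / 2 * Complex.exp (-x j.castSucc) * m j.castSucc * w j with ha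
    set b := z * ∑ j : Fin n,
      1 / 2 * Complex.exp (x j.castSucc) * m j.castSucc * w j with hb
    set X := x (Fin.last n) with hX
    -- Just left of the new site the solution is `a e^x + b e^{-x}`; by continuity this also gives
    -- its value at `X`. Earlier values are unaffected, as `V` is strictly lower triangular.
    refine ⟨Fin.snoc w (a * Complex.exp X + b * Complex.exp (-X)), ?_, ?_⟩
    · intro i
      refine Fin.lastCases ?_ (fun i => ?_) i
      · rw [Fin.sum_univ_castSucc]
        simp only [Fin.snoc_last, Fin.snoc_castSucc, volterraMatrix, Matrix.of_apply,
          Fin.castSucc_lt_last, if_true, lt_irrefl, if_false, zero_mul, add_zero]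
        rw [ha, hb, sub_mul, one_mul, mul_assoc z, mul_assoc z, Finset.sum_mul, Finset.sum_mul,
          sub_add_eq_add_sub, add_sub_assoc, ← mul_sub, ← Finset.sum_sub_distrib]
        congr 2
        refine Finset.sum_congr rfl fun j _ => ?_
        rw [← hX]
        ring
      · rw [Fin.sum_univ_castSucc]
        simp only [Fin.snoc_last, Fin.snoc_castSucc]
        rw [hw i]
        simp [volterraMatrix, (Fin.castSucc_lt_last i).not_gt]
    · rw [transferProduct_succ, ← Matrix.mulVec_mulVec, hT]
      have h1 : Complex.exp (-2 * X) = Complex.exp (-X) * Complex.exp (-X) := by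
        rw [← Complex.exp_add]; ring_nf
      have h2 : Complex.exp (2 * X) = Complex.exp X * Complex.exp X := by
        rw [← Complex.exp_add]; ring_nf
      have h3 : Complex.exp X * Complex.exp (-X) = 1 := by
        rw [← Complex.exp_add]; simp
      rw [Fin.sum_univ_castSucc, Fin.sum_univ_castSucc]
      simp only [Fin.snoc_last, Fin.snoc_castSucc]
      rw [mul_add z, mul_add z, ← hb, ← sub_sub, ← ha, ← hX]
      ext i
      fin_cases i
      · simp [transferMatrix]
        rw [neg_mul] at h1
        rw [h1]
        linear_combination (1 / 2 * m (Fin.last n) * z * a) * h3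
      · simp [transferMatrix]
        rw [h2]
        linear_combination (-1 / 2 * m (Fin.last n) * z * b) * h3

lemma map_greenMatrix_mul_massMatrix {n : ℕ} (x m : Fin n → ℝ) (hx : StrictMono x) :
    (greenMatrix x * massMatrix m).map Complex.ofReal = volterraMatrix x m +
      vecMulVec (fun i => Complex.exp (x i)) fun j => 1 / 2 * Complex.exp (-x j) * m j := by
  ext i j
  simp only [greenMatrix, massMatrix, Matrix.map_apply, Matrix.mul_diagonal, Matrix.of_apply,
    Matrix.add_apply, volterraMatrix, vecMulVec_apply]
  push_cast
  split_ifs with h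
  · rw [abs_of_nonneg (sub_nonneg.2 (hx h).le), Complex.ofReal_sub, neg_sub, Complex.exp_sub,
      Complex.exp_neg, Complex.exp_neg]
    ring
  · rw [abs_of_nonpos (sub_nonpos.2 (hx.monotone (not_lt.1 h))), ← Complex.ofReal_neg, neg_neg, Complex.ofReal_sub,
      Complex.exp_sub, Complex.exp_neg]
    ring

lemma one_sub_smul_green {n : ℕ} (x m : Fin n → ℝ) (hx : StrictMono x) (z : ℂ) :
    1 - z • (greenMatrix x * massMatrix m).map Complex.ofReal = (1 - z • volterraMatrix x m) -
      vecMulVec (fun i => Complex.exp (x i)) (z • fun j => 1 / 2 * Complex.exp (-x j) * m j) := by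
  rw [map_greenMatrix_mul_massMatrix x m hx, smul_add, sub_sub, vecMulVec_smul]

lemma det_one_sub_smul_volterraMatrix {n : ℕ} (x m : Fin n → ℝ) (z : ℂ) :
    (1 - z • volterraMatrix x m).det = 1 := by
  rw [Matrix.det_of_isLowerTriangular]
  · simp [volterraMatrix]
  · intro i j h
    replace h : i < j := h
    simp [volterraMatrix, h.not_gt, h.ne]

lemma exists_volterra_solution {n : ℕ} (x m : Fin n → ℝ) (z : ℂ) :
    ∃ w : Fin n → ℂ, (1 - z • volterraMatrix x m) *ᵥ w = (fun i => Complex.exp (x i)) ∧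
      coeffA x m z = 1 - (z • fun j => 1 / 2 * Complex.exp (-x j) * (m j : ℂ)) ⬝ᵥ w := by
  obtain ⟨w, hw, hT⟩ := exists_transfer_values x m z
  refine ⟨w, ?_, ?_⟩
  · ext i
    rw [Matrix.sub_mulVec, Matrix.one_mulVec, Matrix.smul_mulVec]
    simp only [Pi.sub_apply, Pi.smul_apply, smul_eq_mul, Matrix.mulVec, dotProduct]
    conv_lhs => rw [hw i]
    ring
  · rw [coeffA, hT, smul_dotProduct]
    simp [dotProduct]

/-- Substituting `u = (1 - z V) w` factors `1 - z E P` as `(1 - z V) (1 - w (z v)ᵀ)`: the first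
factor has determinant 1, the second `1 - z vᵀ w`. -/
theorem coeffA_eq_det {n : ℕ} (x m : Fin n → ℝ) (hx : StrictMono x) (z : ℂ) :
    coeffA x m z = (1 - z • (greenMatrix x * massMatrix m).map Complex.ofReal).det := by
  obtain ⟨w, hw, hA⟩ := exists_volterra_solution x m z
  rw [one_sub_smul_green x m hx, hA, ← hw, ← Matrix.mul_vecMulVec]
  conv_rhs => enter [1, 1]; rw [← mul_one (1 - z • volterraMatrix x m)]
  rw [← mul_sub, Matrix.det_mul, det_one_sub_smul_volterraMatrix, one_mul,
    Matrix.vecMulVec_eq Unit, Matrix.det_one_sub_mul_comm]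
  simp [Matrix.replicateRow_mul_replicateCol_apply, dotProduct, Finset.mul_sum, mul_assoc]

/-- The kernel of `1 - z E P` is at most one-dimensional. -/
lemma exists_span_kernel {n : ℕ} (x m : Fin n → ℝ) (hx : StrictMono x) (z : ℂ) :
    ∃ w : Fin n → ℂ, ∀ v : Fin n → ℂ,
      (1 - z • (greenMatrix x * massMatrix m).map Complex.ofReal) *ᵥ v = 0 →
        ∃ c : ℂ, v = c • w := by
  obtain ⟨w, hw, -⟩ := exists_volterra_solution x m z
  refine ⟨w, fun v hv => ⟨(z • fun j => 1 / 2 * Complex.exp (-x j) * (m j : ℂ)) ⬝ᵥ v, ?_⟩⟩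
  rw [one_sub_smul_green x m hx, Matrix.sub_mulVec, Matrix.vecMulVec_mulVec, sub_eq_zero,
    ← hw] at hv
  have hu : IsUnit (1 - z • volterraMatrix x m) := by
    rw [Matrix.isUnit_iff_isUnit_det, det_one_sub_smul_volterraMatrix]; exact isUnit_one
  apply Matrix.mulVec_injective_of_isUnit hu
  rw [hv, Matrix.mulVec_smul]
  ext i
  simp [mul_comm]

/-! ### Positivity and simplicity of the eigenvalues. -/

/-- The kernel `min` is positive definite on distinct positive points. -/
lemma sum_mul_min_pos {n : ℕ} (p : Fin n → ℝ) (hp : StrictMono p) (hpos : ∀ i, 0 < p i)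
    (c : Fin n → ℝ) (hc : c ≠ 0) : 0 < ∑ i, ∑ j, c i * min (p i) (p j) * c j := by
  induction n with
  | zero => exact absurd (Subsingleton.elim _ _) hc
  | succ n ih =>
    -- Peel off the smallest point: `min (p i) (p j) = p 0 + min (p i - p 0) (p j - p 0)`, where the
    -- second term vanishes as soon as one index is 0.
    have key : ∑ i, ∑ j, c i * min (p i) (p j) * c j = p 0 * (∑ i, c i) ^ 2 +
        ∑ i : Fin n, ∑ j : Fin n, c i.succ * min (p i.succ - p 0) (p j.succ - p 0) * c j.succ := by
      have h0 (i) : p 0 ≤ p i := hp.monotone (Fin.zero_le i)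
      have h1 (i j) : c i * min (p i) (p j) * c j =
          c i * min (p i - p 0) (p j - p 0) * c j + p 0 * (c i * c j) := by
        rw [min_sub_sub_right]; ring
      simp_rw [h1, Finset.sum_add_distrib, ← Finset.mul_sum, ← Finset.sum_mul]
      rw [Fin.sum_univ_succ]
      simp_rw [Fin.sum_univ_succ (fun j => c _ * min _ (p j - p 0) * c j)]
      simp [h0]
      ring
    rw [key]
    have h2 : 0 ≤ p 0 * (∑ i, c i) ^ 2 := mul_nonneg (hpos 0).le (sq_nonneg _)
    by_cases ht : (fun i : Fin n => c i.succ) = 0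
    · have h3 (i : Fin n) : c i.succ = 0 := congrFun ht i
      have h4 : c 0 ≠ 0 := fun h => hc (funext fun i => Fin.cases h h3 i)
      simp only [Fin.sum_univ_succ, h3, Finset.sum_const_zero, zero_mul, add_zero, mul_zero]
      exact mul_pos (hpos 0) (by positivity)
    · refine add_pos_of_nonneg_of_pos h2 (ih (fun i => p i.succ - p 0) ?_ ?_ _ ht)
      · intro i j hij
        exact sub_lt_sub_right (hp (Fin.succ_lt_succ_iff.2 hij)) _
      · intro i
        exact sub_pos.2 (hp (Fin.succ_pos i))

lemma greenMatrix_apply_eq {n : ℕ} (x : Fin n → ℝ) (i j : Fin n) :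
    greenMatrix x i j = Real.exp (-x i) * min (Real.exp (2 * x i) / 2) (Real.exp (2 * x j) / 2) *
      Real.exp (-x j) := by
  rw [greenMatrix, Matrix.of_apply]
  rcases le_total (x i) (x j) with h | h
  · have : Real.exp (2 * x i) / 2 ≤ Real.exp (2 * x j) / 2 := by gcongr
    rw [min_eq_left this, abs_of_nonpos (sub_nonpos.2 h), neg_neg,
      show x i - x j = -x i + 2 * x i + -x j by ring, Real.exp_add, Real.exp_add]
    ring
  · have : Real.exp (2 * x j) / 2 ≤ Real.exp (2 * x i) / 2 := by gcongr
    rw [min_eq_right this, abs_of_nonneg (sub_nonneg.2 h),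
      show -(x i - x j) = -x i + 2 * x j + -x j by ring, Real.exp_add, Real.exp_add]
    ring

/-- The symmetrization `P^{1/2} E P^{1/2}`. -/
noncomputable def symmGreen {n : ℕ} (x m : Fin n → ℝ) : Matrix (Fin n) (Fin n) ℝ :=
  diagonal (fun i => √(m i)) * greenMatrix x * diagonal (fun i => √(m i))

lemma symmGreen_apply {n : ℕ} (x m : Fin n → ℝ) (i j : Fin n) :
    symmGreen x m i j = √(m i) * greenMatrix x i j * √(m j) := by
  simp [symmGreen]

lemma posDef_symmGreen {n : ℕ} (x m : Fin n → ℝ) (hx : StrictMono x) (hm : ∀ j, 0 < m j) :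
    (symmGreen x m).PosDef := by
  refine Matrix.PosDef.of_dotProduct_mulVec_pos ?_ fun v hv => ?_
  · ext i j
    simp only [conjTranspose_apply, star_trivial, symmGreen_apply, greenMatrix, of_apply]
    rw [abs_sub_comm]
    ring
  · have h := sum_mul_min_pos (fun i => Real.exp (2 * x i) / 2)
      (fun i j hij => by
        have := hx hij
        simp only
        gcongr)
      (fun i => by positivity) (fun i => Real.exp (-x i) * √(m i) * v i) (by
        obtain ⟨i, hi⟩ := Function.ne_iff.1 hv
        refine Function.ne_iff.2 ⟨i, ?_⟩
        have := Real.sqrt_pos.2 (hm i)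
        exact mul_ne_zero (by positivity) hi)
    refine h.trans_eq ?_
    simp only [star_trivial, dotProduct, mulVec, symmGreen_apply, greenMatrix_apply_eq,
      Finset.mul_sum]
    refine Finset.sum_congr rfl fun i _ => Finset.sum_congr rfl fun j _ => ?_
    ring

lemma det_one_sub_smul_eq_prod {n : ℕ} (H : Matrix (Fin n) (Fin n) ℝ) (hH : H.IsHermitian)
    (z : ℂ) : (1 - z • H.map Complex.ofReal).det = ∏ k, (1 - z * (hH.eigenvalues k : ℂ)) := by
  rcases eq_or_ne z 0 with rfl | hz
  · simp
  have h1 : (1 - z • H.map Complex.ofReal) =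
      z • (Matrix.scalar (Fin n) z⁻¹ - H.map Complex.ofRealHom) := by
    rw [smul_sub]
    congr 1
    ext i j
    by_cases h : i = j
    · subst h; simp [hz]
    · simp [h]
  rw [h1, Matrix.det_smul, ← Matrix.eval_charpoly, Matrix.charpoly_map, hH.charpoly_eq,
    Polynomial.map_prod, Polynomial.eval_prod, Fintype.card_fin]
  rw [← Fin.prod_const, ← Finset.prod_mul_distrib]
  refine Finset.prod_congr rfl fun k _ => ?_
  simp [mul_sub, hz]

lemma det_one_sub_smul_green {n : ℕ} (x m : Fin n → ℝ) (hm : ∀ j, 0 < m j) (z : ℂ) :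
    (1 - z • (greenMatrix x * massMatrix m).map Complex.ofReal).det =
      (1 - z • (symmGreen x m).map Complex.ofReal).det := by
  have hS : massMatrix m = diagonal (fun i => √(m i)) * diagonal (fun i => √(m i)) := by
    rw [massMatrix, diagonal_mul_diagonal]
    congr 1
    ext i
    exact (Real.mul_self_sqrt (hm i).le).symm
  have hmap (A B : Matrix (Fin n) (Fin n) ℝ) :
      (A * B).map Complex.ofReal = A.map Complex.ofReal * B.map Complex.ofReal :=
    Matrix.map_mul (f := Complex.ofRealHom)
  rw [hS, ← Matrix.mul_assoc, hmap, ← Matrix.smul_mul, Matrix.det_one_sub_mul_comm,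
    Matrix.mul_smul, ← hmap, symmGreen, Matrix.mul_assoc]

/-- If `y` is an eigenvector of `P^{1/2} E P^{1/2}` for `μ`, then `P^{-1/2} y` lies in the kernel of
`1 - μ⁻¹ E P`, which is at most a line. Two orthonormal eigenvectors for the same `μ` would be
proportional. -/
lemma eigenvalues_symmGreen_injective {n : ℕ} (x m : Fin n → ℝ) (hx : StrictMono x)
    (hm : ∀ j, 0 < m j) :
    Function.Injective (posDef_symmGreen x m hx hm).1.eigenvalues := by
  set hH := (posDef_symmGreen x m hx hm).1
  intro i j hij
  by_contra hne
  set μ := hH.eigenvalues i with hμ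
  have hμpos : 0 < μ := (posDef_symmGreen x m hx hm).eigenvalues_pos i
  obtain ⟨w, hw⟩ := exists_span_kernel x m hx ((μ : ℂ)⁻¹)
  have hker (k) (hk : hH.eigenvalues k = μ) : ∃ c : ℂ,
      (fun l => ((hH.eigenvectorBasis k l / √(m l) : ℝ) : ℂ)) = c • w := by
    apply hw
    have he := hH.mulVec_eigenvectorBasis k
    rw [hk] at he
    ext l
    have hl := congrFun he l
    have hsl := Real.sqrt_pos.2 (hm l)
    simp only [mulVec, dotProduct, symmGreen_apply, Pi.smul_apply, smul_eq_mul] at hl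
    have hl' : ∑ j, (greenMatrix x * massMatrix m) l j * (hH.eigenvectorBasis k j / √(m j)) =
        μ * (hH.eigenvectorBasis k l / √(m l)) := by
      rw [mul_div_assoc', eq_div_iff hsl.ne', ← hl, Finset.sum_mul]
      refine Finset.sum_congr rfl fun j _ => ?_
      have hsj := Real.sqrt_pos.2 (hm j)
      rw [massMatrix, mul_diagonal]
      conv_lhs => enter [1, 1, 2]; rw [← Real.mul_self_sqrt (hm j).le]
      field_simp
    rw [sub_mulVec, one_mulVec, smul_mulVec]
    simp only [Pi.sub_apply, Pi.smul_apply, mulVec, dotProduct, map_apply, Pi.zero_apply,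
      smul_eq_mul, ← Complex.ofReal_mul, ← Complex.ofReal_sum]
    rw [hl', ← Complex.ofReal_inv, ← Complex.ofReal_mul, inv_mul_cancel_left₀ hμpos.ne', sub_self]
  obtain ⟨c, hc⟩ := hker i rfl
  obtain ⟨d, hd⟩ := hker j hij.symm
  have hlin (l) : d * (hH.eigenvectorBasis i l : ℂ) = c * (hH.eigenvectorBasis j l : ℂ) := by
    have h1 := congrFun hc l
    have h2 := congrFun hd l
    have hsl : ((√(m l) : ℝ) : ℂ) ≠ 0 := Complex.ofReal_ne_zero.2 (Real.sqrt_pos.2 (hm l)).ne'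
    simp only [Pi.smul_apply, smul_eq_mul, Complex.ofReal_div] at h1 h2
    rw [div_eq_iff hsl] at h1 h2
    rw [h1, h2]; ring
  have hinner (a b) : ∑ l, (hH.eigenvectorBasis a l : ℂ) * (hH.eigenvectorBasis b l : ℂ) =
      if a = b then 1 else 0 := by
    have := orthonormal_iff_ite.1 hH.eigenvectorBasis.orthonormal b a
    rw [PiLp.inner_apply] at this
    simp only [RCLike.inner_apply, conj_trivial] at this
    simp only [eq_comm (a := b)] at this
    have h := congrArg Complex.ofReal this
    rw [apply_ite Complex.ofReal] at h
    push_cast at h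
    exact h
  -- Pair the proportionality relation with the `i`-th eigenvector; `d = 0` then makes the `j`-th
  -- eigenvector vanish.
  have hd0 : d = 0 := by
    have h1 := hinner i i
    have h2 := hinner j i
    rw [if_neg (Ne.symm hne)] at h2
    rw [if_pos rfl] at h1
    calc d = ∑ l, (d * hH.eigenvectorBasis i l) * (hH.eigenvectorBasis i l : ℂ) := by
          simp_rw [mul_assoc]; rw [← Finset.mul_sum, h1, mul_one]
      _ = c * ∑ l, hH.eigenvectorBasis j l * (hH.eigenvectorBasis i l : ℂ) := by
          rw [Finset.mul_sum]; exact Finset.sum_congr rfl fun l _ => by rw [hlin]; ring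
      _ = 0 := by rw [h2, mul_zero]
  have h3 := hinner j j
  have h4 (l) : (hH.eigenvectorBasis j l : ℂ) = 0 := by
    have h2 := congrFun hd l
    have hsl : ((√(m l) : ℝ) : ℂ) ≠ 0 := Complex.ofReal_ne_zero.2 (Real.sqrt_pos.2 (hm l)).ne'
    simp only [hd0, zero_smul, Pi.zero_apply, Complex.ofReal_div] at h2
    rwa [div_eq_zero_iff, or_iff_left hsl] at h2
  simp [h4] at h3

theorem exists_factorization {n : ℕ} (x m : Fin n → ℝ) (hx : StrictMono x)
    (hm : ∀ j, 0 < m j) : ∃ l : Fin n → ℝ, (∀ k, 0 < l k) ∧ StrictMono l ∧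
      ∀ z : ℂ, (1 - z • (greenMatrix x * massMatrix m).map Complex.ofReal).det =
        ∏ k, (1 - z / (l k : ℂ)) := by
  have hP := posDef_symmGreen x m hx hm
  set f : Fin n → ℝ := fun k => (hP.1.eigenvalues k)⁻¹ with hf
  have hinj : Function.Injective f :=
    inv_injective.comp (eigenvalues_symmGreen_injective x m hx hm)
  refine ⟨f ∘ Tuple.sort f, fun k => inv_pos.2 (hP.eigenvalues_pos _),
    (Tuple.monotone_sort f).strictMono_of_injective (hinj.comp (Tuple.sort f).injective), ?_⟩
  intro z
  rw [det_one_sub_smul_green x m hm, det_one_sub_smul_eq_prod _ hP.1,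
    ← Equiv.prod_comp (Tuple.sort f)]
  simp [hf]

/-! ### Uniqueness for the homogeneous equation. -/

open MeasureTheory Filter

/-- Both `(F + F') e^{-t}` and `(F - F') e^t` are constant, so `F` is a combination of `e^t` and
`e^{-t}`; decay at each end kills one coefficient. -/
lemma eq_zero_of_hasDerivAt_of_tendsto {F F' : ℝ → ℂ} (h1 : ∀ t, HasDerivAt F (F' t) t)
    (h2 : ∀ t, HasDerivAt F' (F t) t) (hbot : Tendsto F atBot (𝓝 0))
    (htop : Tendsto F atTop (𝓝 0)) : F = 0 := by
  have hexp (t : ℝ) : HasDerivAt (fun t : ℝ => Complex.exp t) (Complex.exp t) t :=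
    (Complex.hasDerivAt_exp t).comp_ofReal
  have hexpn (t : ℝ) : HasDerivAt (fun t : ℝ => Complex.exp (-t)) (-Complex.exp (-t)) t := by
    have := (((hasDerivAt_id (t : ℂ)).neg).cexp).comp_ofReal
    simpa using this
  have hc (t : ℝ) : HasDerivAt (fun t : ℝ => (F t + F' t) * Complex.exp (-t)) 0 t := by
    refine (((h1 t).add (h2 t)).mul (hexpn t)).congr_deriv ?_
    simp only [Pi.add_apply]
    ring
  have hd (t : ℝ) : HasDerivAt (fun t : ℝ => (F t - F' t) * Complex.exp t) 0 t := by
    refine (((h1 t).sub (h2 t)).mul (hexp t)).congr_deriv ?_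
    simp only [Pi.sub_apply]
    ring
  have hc' (t : ℝ) : (F t + F' t) * Complex.exp (-t) = F 0 + F' 0 := by
    have := is_const_of_deriv_eq_zero (fun t => (hc t).differentiableAt)
      (fun t => (hc t).deriv) t 0
    simpa using this
  have hd' (t : ℝ) : (F t - F' t) * Complex.exp t = F 0 - F' 0 := by
    have := is_const_of_deriv_eq_zero (fun t => (hd t).differentiableAt)
      (fun t => (hd t).deriv) t 0
    simpa using this
  have hmul (t : ℝ) : Complex.exp t * Complex.exp (-t) = 1 := by
    rw [← Complex.exp_add]; simp
  have hF (t : ℝ) : 2 * F t = (F 0 + F' 0) * Complex.exp t + (F 0 - F' 0) * Complex.exp (-t) := by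
    rw [← hc' t, ← hd' t]
    linear_combination (-2 * F t) * hmul t
  have hen : Tendsto (fun t : ℝ => Complex.exp (-t)) atTop (𝓝 0) := by
    have := (Complex.continuous_ofReal.tendsto 0).comp Real.tendsto_exp_neg_atTop_nhds_zero
    simpa [Function.comp_def] using this
  have hep : Tendsto (fun t : ℝ => Complex.exp t) atBot (𝓝 0) := by
    have := (Complex.continuous_ofReal.tendsto 0).comp Real.tendsto_exp_atBot
    simpa [Function.comp_def] using this
  have hC : F 0 + F' 0 = 0 := by
    have e (t : ℝ) : F 0 + F' 0 =
        2 * F t * Complex.exp (-t) - (F 0 - F' 0) * Complex.exp (-t) * Complex.exp (-t) := by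
      rw [hF t]
      linear_combination (-(F 0 + F' 0)) * hmul t
    have l : Tendsto (fun t : ℝ => 2 * F t * Complex.exp (-t) -
        (F 0 - F' 0) * Complex.exp (-t) * Complex.exp (-t)) atTop (𝓝 0) := by
      simpa using ((htop.const_mul 2).mul hen).sub ((hen.const_mul (F 0 - F' 0)).mul hen)
    simp_rw [← e] at l
    exact tendsto_nhds_unique tendsto_const_nhds l
  have hD : F 0 - F' 0 = 0 := by
    have e (t : ℝ) : F 0 - F' 0 =
        2 * F t * Complex.exp t - (F 0 + F' 0) * Complex.exp t * Complex.exp t := by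
      rw [hF t]
      linear_combination (-(F 0 - F' 0)) * hmul t
    have l : Tendsto (fun t : ℝ => 2 * F t * Complex.exp t -
        (F 0 + F' 0) * Complex.exp t * Complex.exp t) atBot (𝓝 0) := by
      simpa using ((hbot.const_mul 2).mul hep).sub ((hep.const_mul (F 0 + F' 0)).mul hep)
    simp_rw [← e] at l
    exact tendsto_nhds_unique tendsto_const_nhds l
  ext t
  have := hF t
  rw [hC, hD] at this
  simpa using this

lemma exists_norm_bound {h : ℝ → ℂ} (hc : Continuous h) (hbot : Tendsto h atBot (𝓝 0))
    (htop : Tendsto h atTop (𝓝 0)) : ∃ C, ∀ t, ‖h t‖ ≤ C := by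
  have hcc : Tendsto h (cocompact ℝ) (𝓝 0) := by
    rw [cocompact_eq_atBot_atTop]
    exact hbot.sup htop
  let f : ZeroAtInftyContinuousMap ℝ ℂ := ⟨⟨h, hc⟩, hcc⟩
  exact ⟨‖f.toBCF‖, fun t => f.toBCF.norm_coe_le_norm t⟩

/-- The homogeneous equation has no nonzero decaying distributional solution. -/
lemma eq_zero_of_weak_homogeneous {h : ℝ → ℂ} (hc : Continuous h)
    (hbot : Tendsto h atBot (𝓝 0)) (htop : Tendsto h atTop (𝓝 0))
    (heq : ∀ φ : ℝ → ℂ, ContDiff ℝ ∞ φ → HasCompactSupport φ →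
      ∫ y, h y * (φ y - deriv (deriv φ) y) = 0) : h = 0 := by
  have hloc : LocallyIntegrable h volume := hc.locallyIntegrable
  -- Mollify: `h ⋆ φ` is a classical decaying solution of `F'' = F`, hence zero. Its value at 0
  -- pairs `h` with the reflected test function.
  have key : ∀ φ : ℝ → ℂ, ContDiff ℝ ∞ φ → HasCompactSupport φ → ∫ y, h y * φ (-y) = 0 := by
    intro φ hφ hs
    have hφ1 : ContDiff ℝ ∞ (deriv φ) := by
      exact (contDiff_infty_iff_deriv.1 hφ).2
    have hφ2 : ContDiff ℝ ∞ (deriv (deriv φ)) := (contDiff_infty_iff_deriv.1 hφ1).2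
    set L := ContinuousLinearMap.mul ℝ ℂ
    have hconv (g : ℝ → ℂ) (t : ℝ) : convolution h g L volume t = ∫ y, h y * g (t - y) := rfl
    have hconv' (g : ℝ → ℂ) (t : ℝ) : convolution h g L volume t = ∫ y, h (t - y) * g y := by
      rw [convolution_eq_swap]; rfl
    have h1 := hs.hasDerivAt_convolution_right L hloc (hφ.of_le (by simp))
    have h2 := hs.deriv.hasDerivAt_convolution_right L hloc (hφ1.of_le (by simp))
    have hprod (g : ℝ → ℂ) (hg : Continuous g) (hgs : HasCompactSupport g) (t : ℝ) :
        Integrable (fun y => h y * g (t - y)) := by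
      refine Continuous.integrable_of_hasCompactSupport (by fun_prop) ?_
      have : HasCompactSupport fun y => g (t - y) :=
        hgs.comp_homeomorph (Homeomorph.subLeft t)
      exact this.mul_left
    have h3 (t : ℝ) : convolution h (deriv (deriv φ)) L volume t = convolution h φ L volume t := by
      have e := heq (fun y => φ (t - y)) (hφ.comp (contDiff_const.sub contDiff_id))
        (hs.comp_homeomorph (Homeomorph.subLeft t))
      have d1 : deriv (fun y => φ (t - y)) = fun y => -deriv φ (t - y) := by
        ext y; exact deriv_comp_const_sub ..
      have d2 : deriv (deriv fun y => φ (t - y)) = fun y => deriv (deriv φ) (t - y) := by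
        ext y
        rw [d1, deriv.fun_neg, deriv_comp_const_sub, neg_neg]
      simp_rw [d2, mul_sub] at e
      rw [integral_sub (hprod _ hφ.continuous hs t) (hprod _ hφ2.continuous hs.deriv.deriv t),
        sub_eq_zero] at e
      rw [hconv, hconv, e]
    obtain ⟨C, hC⟩ := exists_norm_bound hc hbot htop
    have lim (l l' : Filter ℝ) [l.IsCountablyGenerated] (hl : Tendsto h l' (𝓝 0))
        (hll : ∀ y, Tendsto (fun t => t - y) l l') :
        Tendsto (convolution h φ L volume) l (𝓝 0) := by
      have : Tendsto (fun t => ∫ y, h (t - y) * φ y) l (𝓝 (∫ _ : ℝ, (0 : ℂ))) := by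
        refine tendsto_integral_filter_of_dominated_convergence (fun y => C * ‖φ y‖) ?_ ?_ ?_ ?_
        · exact Eventually.of_forall fun t =>
            (Continuous.mul (by fun_prop) hφ.continuous).aestronglyMeasurable
        · refine Eventually.of_forall fun t => Eventually.of_forall fun y => ?_
          rw [norm_mul]
          gcongr
          exact hC _
        · exact ((hφ.continuous.integrable_of_hasCompactSupport hs).norm).const_mul C
        · refine Eventually.of_forall fun y => ?_
          simpa using (hl.comp (hll y)).mul_const (φ y)
      simpa [hconv'] using (this.congr fun t => (hconv' φ t).symm)
    have hz := eq_zero_of_hasDerivAt_of_tendsto h1 (fun t => (h3 t) ▸ h2 t)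
      (lim atBot atBot hbot fun y => tendsto_atBot_add_const_right _ (-y) tendsto_id)
      (lim atTop atTop htop fun y => tendsto_atTop_add_const_right _ (-y) tendsto_id)
    have := congrFun hz 0
    rw [hconv] at this
    simpa using this
  have hae : ∀ᵐ y, h y = 0 := by
    refine ae_eq_zero_of_integral_contDiff_smul_eq_zero hloc fun g hg hgs => ?_
    have e := key (fun y => ((g (-y) : ℝ) : ℂ))
      (Complex.ofRealCLM.contDiff.comp (hg.comp contDiff_neg))
      ((hgs.comp_homeomorph (Homeomorph.neg ℝ)).comp_left (g := Complex.ofReal)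
        Complex.ofReal_zero)
    simp only [neg_neg] at e
    rw [← e]
    refine integral_congr_ae (Eventually.of_forall fun y => ?_)
    simp [mul_comm]
  exact (hc.ae_eq_iff_eq volume continuous_const).1 hae

/-! ### Green's function and reduction to the matrix kernel. -/

/-- The fundamental solution of `1 - D²` centred at `a`. -/
noncomputable def greenFunction (a y : ℝ) : ℂ := ((1 / 2 * Real.exp (-|y - a|) : ℝ) : ℂ)

lemma continuous_greenFunction (a : ℝ) : Continuous (greenFunction a) := by
  unfold greenFunction; fun_prop

lemma tendsto_greenFunction_atTop (a : ℝ) : Tendsto (greenFunction a) atTop (𝓝 0) := by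
  have h : Tendsto (fun y : ℝ => 1 / 2 * Real.exp (-|y - a|)) atTop (𝓝 (1 / 2 * 0)) :=
    (Real.tendsto_exp_neg_atTop_nhds_zero.comp (tendsto_abs_atTop_atTop.comp
      (tendsto_atTop_add_const_right _ (-a) tendsto_id))).const_mul _
  have := (Complex.continuous_ofReal.tendsto _).comp h
  rw [mul_zero, Complex.ofReal_zero] at this
  exact this

lemma tendsto_greenFunction_atBot (a : ℝ) : Tendsto (greenFunction a) atBot (𝓝 0) := by
  have h : Tendsto (fun y : ℝ => 1 / 2 * Real.exp (-|y - a|)) atBot (𝓝 (1 / 2 * 0)) :=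
    (Real.tendsto_exp_neg_atTop_nhds_zero.comp (tendsto_abs_atBot_atTop.comp
      (tendsto_atBot_add_const_right _ (-a) tendsto_id))).const_mul _
  have := (Complex.continuous_ofReal.tendsto _).comp h
  rw [mul_zero, Complex.ofReal_zero] at this
  exact this

lemma integrable_mul_test {f φ : ℝ → ℂ} (hf : Continuous f) (hφ : ContDiff ℝ ∞ φ)
    (hs : HasCompactSupport φ) : Integrable fun y => f y * (φ y - deriv (deriv φ) y) := by
  have hφ2 : Continuous (deriv (deriv φ)) :=
    ((contDiff_infty_iff_deriv.1 (contDiff_infty_iff_deriv.1 hφ).2).2).continuous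
  exact (hf.mul (hφ.continuous.sub hφ2)).integrable_of_hasCompactSupport
    ((hs.sub hs.deriv.deriv).mul_left)

/-- On each side of `a` the integrand is an exact derivative. The boundary terms at `a` are `(φ -
φ')/2` and `(φ + φ')/2`, which add up to `φ a`. -/
lemma integral_greenFunction_mul (a : ℝ) {φ : ℝ → ℂ} (hφ : ContDiff ℝ ∞ φ)
    (hs : HasCompactSupport φ) :
    ∫ y, greenFunction a y * (φ y - deriv (deriv φ) y) = φ a := by
  have hφ1 : ContDiff ℝ ∞ (deriv φ) := (contDiff_infty_iff_deriv.1 hφ).2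
  have d1 (y : ℝ) : HasDerivAt φ (deriv φ y) y :=
    ((contDiff_infty_iff_deriv.1 hφ).1 y).hasDerivAt
  have d2 (y : ℝ) : HasDerivAt (deriv φ) (deriv (deriv φ) y) y :=
    ((contDiff_infty_iff_deriv.1 hφ1).1 y).hasDerivAt
  have hexp (y : ℝ) : HasDerivAt (fun y : ℝ => Complex.exp (y - a)) (Complex.exp (y - a)) y := by
    have := (((hasDerivAt_id (y : ℂ)).sub_const (a : ℂ)).cexp).comp_ofReal
    simpa using this
  have hexpn (y : ℝ) :
      HasDerivAt (fun y : ℝ => Complex.exp (a - y)) (-Complex.exp (a - y)) y := by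
    have := (((hasDerivAt_id (y : ℂ)).const_sub (a : ℂ)).cexp).comp_ofReal
    simpa using this
  have hI := integrable_mul_test (continuous_greenFunction a) hφ hs
  have D1 (y : ℝ) : HasDerivAt (fun y : ℝ => 1 / 2 * (Complex.exp (y - a) * (φ y - deriv φ y)))
      (1 / 2 * Complex.exp (y - a) * (φ y - deriv (deriv φ) y)) y := by
    refine (((hexp y).mul ((d1 y).sub (d2 y))).const_mul (1 / 2 : ℂ)).congr_deriv ?_
    simp only [Pi.sub_apply]
    ring
  have D2 (y : ℝ) : HasDerivAt
      (fun y : ℝ => -(1 / 2) * (Complex.exp (a - y) * (φ y + deriv φ y)))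
      (1 / 2 * Complex.exp (a - y) * (φ y - deriv (deriv φ) y)) y := by
    refine (((hexpn y).mul ((d1 y).add (d2 y))).const_mul (-(1 / 2) : ℂ)).congr_deriv ?_
    simp only [Pi.add_apply]
    ring
  have g1 : Set.EqOn (fun y => greenFunction a y * (φ y - deriv (deriv φ) y))
      (fun y => 1 / 2 * Complex.exp (y - a) * (φ y - deriv (deriv φ) y)) (Set.Iic a) := by
    intro y hy
    simp only [greenFunction]
    rw [abs_of_nonpos (sub_nonpos.2 hy), neg_neg]
    push_cast
    ring
  have g2 : Set.EqOn (fun y => greenFunction a y * (φ y - deriv (deriv φ) y))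
      (fun y => 1 / 2 * Complex.exp (a - y) * (φ y - deriv (deriv φ) y)) (Set.Ioi a) := by
    intro y hy
    simp only [greenFunction]
    rw [abs_of_nonneg (sub_nonneg.2 (le_of_lt hy)), neg_sub]
    push_cast
    ring
  have lim {f : ℝ → ℂ} (hf : HasCompactSupport f) :
      Tendsto f atBot (𝓝 0) ∧ Tendsto f atTop (𝓝 0) := by
    rw [← tendsto_sup, ← cocompact_eq_atBot_atTop]
    exact hf.is_zero_at_infty
  have s1 : HasCompactSupport
      (fun y : ℝ => 1 / 2 * (Complex.exp (y - a) * (φ y - deriv φ y))) :=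
    ((hs.sub hs.deriv).mul_left (f := fun y : ℝ => Complex.exp (y - a))).mul_left
      (f := fun _ => (1 / 2 : ℂ))
  have s2 : HasCompactSupport
      (fun y : ℝ => -(1 / 2) * (Complex.exp (a - y) * (φ y + deriv φ y))) :=
    ((hs.add hs.deriv).mul_left (f := fun y : ℝ => Complex.exp (a - y))).mul_left
      (f := fun _ => (-(1 / 2) : ℂ))
  have i1 := integral_Iic_of_hasDerivAt_of_tendsto' (a := a) (fun y _ => D1 y)
    (hI.integrableOn.congr_fun g1 measurableSet_Iic) (lim s1).1
  have i2 := integral_Ioi_of_hasDerivAt_of_tendsto' (a := a) (fun y _ => D2 y)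
    (hI.integrableOn.congr_fun g2 measurableSet_Ioi) (lim s2).2
  rw [← intervalIntegral.integral_Iic_add_Ioi (b := a) hI.integrableOn hI.integrableOn,
    setIntegral_congr_fun measurableSet_Iic g1, setIntegral_congr_fun measurableSet_Ioi g2, i1, i2]
  simp only [sub_self, Complex.exp_zero]
  ring

lemma integral_peakonMeasure {n : ℕ} (x m : Fin n → ℝ) (hm : ∀ j, 0 < m j) (f : ℝ → ℂ) :
    ∫ y, f y ∂(peakonMeasure x m) = ∑ j, (m j : ℂ) * f (x j) := by
  rw [peakonMeasure, integral_finsetSum_measure]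
  · refine Finset.sum_congr rfl fun j _ => ?_
    rw [integral_smul_measure, integral_dirac, ENNReal.toReal_ofReal (hm j).le]
    simp
  · intro j _
    exact (integrable_dirac (by simp)).smul_measure ENNReal.ofReal_ne_top

/-- The solutions of the boundary value problem are the solutions of the integral equation
`ψ = z G (M ψ)`, where `G` is the Green operator of `1 - D²`. -/
lemma isSolution_iff {n : ℕ} (x m : Fin n → ℝ) (hm : ∀ j, 0 < m j) (z : ℂ) (ψ : ℝ → ℂ) :
    IsSolution x m z ψ ↔
      ψ = fun y => ∑ j, (z * (m j : ℂ) * ψ (x j)) * greenFunction (x j) y := by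
  have hGc (c : Fin n → ℂ) : Continuous fun y => ∑ j, c j * greenFunction (x j) y :=
    continuous_finsetSum _ fun j _ => (continuous_greenFunction _).const_mul _
  have hGbot (c : Fin n → ℂ) :
      Tendsto (fun y => ∑ j, c j * greenFunction (x j) y) atBot (𝓝 0) := by
    simpa using tendsto_finsetSum Finset.univ fun j _ =>
      (tendsto_greenFunction_atBot (x j)).const_mul (c j)
  have hGtop (c : Fin n → ℂ) :
      Tendsto (fun y => ∑ j, c j * greenFunction (x j) y) atTop (𝓝 0) := by
    simpa using tendsto_finsetSum Finset.univ fun j _ =>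
      (tendsto_greenFunction_atTop (x j)).const_mul (c j)
  have hGint (c : Fin n → ℂ) {φ : ℝ → ℂ} (hφ : ContDiff ℝ ∞ φ) (hs : HasCompactSupport φ) :
      ∫ y, (∑ j, c j * greenFunction (x j) y) * (φ y - deriv (deriv φ) y) =
        ∑ j, c j * φ (x j) := by
    simp_rw [Finset.sum_mul, mul_assoc]
    rw [integral_finsetSum _ fun j _ =>
      (integrable_mul_test (continuous_greenFunction (x j)) hφ hs).const_mul (c j)]
    refine Finset.sum_congr rfl fun j _ => ?_
    rw [integral_const_mul, integral_greenFunction_mul _ hφ hs]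
  constructor
  · intro h
    -- The difference of the two sides is a decaying weak solution of the homogeneous equation.
    rw [← sub_eq_zero]
    refine eq_zero_of_weak_homogeneous (h.continuous.sub (hGc _))
      (sub_zero (0 : ℂ) ▸ h.tendsto_atBot.sub (hGbot _))
      (sub_zero (0 : ℂ) ▸ h.tendsto_atTop.sub (hGtop _)) fun φ hφ hs => ?_
    simp only [Pi.sub_apply, sub_mul]
    rw [integral_sub (integrable_mul_test h.continuous hφ hs)
      (integrable_mul_test (hGc _) hφ hs), hGint _ hφ hs, h.equation φ hφ hs,
      integral_peakonMeasure x m hm, Finset.mul_sum, ← Finset.sum_sub_distrib]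
    refine Finset.sum_eq_zero fun j _ => ?_
    ring
  · intro h
    refine ⟨?_, ?_, ?_, fun φ hφ hs => ?_⟩
    · rw [h]; exact hGc _
    · rw [h]; exact hGbot _
    · rw [h]; exact hGtop _
    · rw [integral_peakonMeasure x m hm, Finset.mul_sum]
      conv_lhs => rw [h]
      rw [hGint _ hφ hs]
      refine Finset.sum_congr rfl fun j _ => ?_
      ring

lemma greenFunction_apply {n : ℕ} (x : Fin n → ℝ) (i j : Fin n) :
    greenFunction (x j) (x i) = (greenMatrix x i j : ℂ) := rfl

lemma one_sub_smul_green_mulVec_eq_zero_iff {n : ℕ} (x m : Fin n → ℝ) (z : ℂ) (v : Fin n → ℂ) :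
    (1 - z • (greenMatrix x * massMatrix m).map Complex.ofReal) *ᵥ v = 0 ↔
      ∀ i, v i = ∑ j, (z * (m j : ℂ) * v j) * greenFunction (x j) (x i) := by
  rw [sub_mulVec, one_mulVec, smul_mulVec, sub_eq_zero, funext_iff]
  refine forall_congr' fun i => ?_
  simp only [Pi.smul_apply, mulVec, dotProduct, map_apply, massMatrix, mul_diagonal, smul_eq_mul,
    greenFunction_apply, Finset.mul_sum, Complex.ofReal_mul]
  have (j : Fin n) : z * ((greenMatrix x i j : ℂ) * m j * v j) =
      z * m j * v j * greenMatrix x i j := by ring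
  simp_rw [this]

lemma IsSolution.mulVec_eq_zero {n : ℕ} {x m : Fin n → ℝ} (hm : ∀ j, 0 < m j) {z : ℂ}
    {ψ : ℝ → ℂ} (h : IsSolution x m z ψ) :
    (1 - z • (greenMatrix x * massMatrix m).map Complex.ofReal) *ᵥ (fun i => ψ (x i)) = 0 :=
  (one_sub_smul_green_mulVec_eq_zero_iff x m z _).2 fun i =>
    congrFun ((isSolution_iff x m hm z ψ).1 h) (x i)

/-- A solution is determined by its values at the sites `x_j`. -/
lemma IsSolution.eq_smul {n : ℕ} {x m : Fin n → ℝ} (hm : ∀ j, 0 < m j) {z : ℂ} {ψ χ : ℝ → ℂ}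
    (hχ : IsSolution x m z χ) (hψ : IsSolution x m z ψ) (c : ℂ)
    (h : ∀ j, χ (x j) = c * ψ (x j)) : χ = c • ψ := by
  rw [(isSolution_iff x m hm z χ).1 hχ]
  conv_rhs => rw [(isSolution_iff x m hm z ψ).1 hψ]
  ext y
  rw [Pi.smul_apply, smul_eq_mul, Finset.mul_sum]
  refine Finset.sum_congr rfl fun j _ => ?_
  rw [h]
  ring

lemma exists_isSolution {n : ℕ} {x m : Fin n → ℝ} (hm : ∀ j, 0 < m j) {z : ℂ} {v : Fin n → ℂ}
    (hv : (1 - z • (greenMatrix x * massMatrix m).map Complex.ofReal) *ᵥ v = 0) :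
    ∃ ψ, IsSolution x m z ψ ∧ ∀ j, ψ (x j) = v j := by
  have hv' := (one_sub_smul_green_mulVec_eq_zero_iff x m z v).1 hv
  refine ⟨fun y => ∑ j, (z * (m j : ℂ) * v j) * greenFunction (x j) y, ?_,
    fun j => (hv' j).symm⟩
  rw [isSolution_iff x m hm]
  simp_rw [← hv']

theorem mem_bvpSpectrum_iff {n : ℕ} (x m : Fin n → ℝ) (hm : ∀ j, 0 < m j) (z : ℂ) :
    z ∈ bvpSpectrum x m ↔
      (1 - z • (greenMatrix x * massMatrix m).map Complex.ofReal).det = 0 := by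
  rw [← Matrix.exists_mulVec_eq_zero_iff]
  constructor
  · rintro ⟨ψ, hψ, hne⟩
    refine ⟨_, fun h0 => hne ?_, hψ.mulVec_eq_zero hm⟩
    have := hψ.eq_smul hm hψ 0 fun j => by rw [zero_mul]; exact congrFun h0 j
    rwa [zero_smul] at this
  · rintro ⟨v, hne, hv⟩
    obtain ⟨ψ, hψ, hval⟩ := exists_isSolution hm hv
    exact ⟨ψ, hψ, fun h0 => hne (funext fun j => by rw [← hval, h0]; rfl)⟩

theorem isSimpleEigenvalue_of_mem_bvpSpectrum {n : ℕ} (x m : Fin n → ℝ) (hx : StrictMono x)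
    (hm : ∀ j, 0 < m j) {z : ℂ} (hz : z ∈ bvpSpectrum x m) : IsSimpleEigenvalue x m z := by
  obtain ⟨ψ, hψ, hne⟩ := hz
  obtain ⟨w, hw⟩ := exists_span_kernel x m hx z
  obtain ⟨a, ha⟩ := hw _ (hψ.mulVec_eq_zero hm)
  -- The vector `w` spans the kernel only as an upper bound, so solutions are compared through their
  -- coefficients along `w`; the ratio `b / a` needs `a ≠ 0`.
  have ha0 : a ≠ 0 := by
    rintro rfl
    refine hne ?_
    have := hψ.eq_smul hm hψ 0 fun j => by simpa using congrFun ha j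
    rwa [zero_smul] at this
  refine ⟨ψ, hψ, hne, fun χ hχ => ?_⟩
  obtain ⟨b, hb⟩ := hw _ (hχ.mulVec_eq_zero hm)
  refine ⟨b / a, hχ.eq_smul hm hψ _ fun j => ?_⟩
  have h1 := congrFun ha j
  have h2 := congrFun hb j
  simp only [Pi.smul_apply, smul_eq_mul] at h1 h2
  rw [h1, h2]
  field_simp

end Peakon

theorem mainTheorem5 (n : ℕ) (x m : Fin n → ℝ) (hx : StrictMono x) (hm : ∀ j, 0 < m j) :
    (∀ z : ℂ, Peakon.coeffA x m z =
      (1 - z • (Peakon.greenMatrix x * Peakon.massMatrix m).map Complex.ofReal).det) ∧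
    ∃ l : Fin n → ℝ, (∀ k, 0 < l k) ∧ StrictMono l ∧
      (∀ z : ℂ,
        (1 - z • (Peakon.greenMatrix x * Peakon.massMatrix m).map Complex.ofReal).det =
          ∏ k, (1 - z / (l k : ℂ))) ∧
      Peakon.bvpSpectrum x m = Set.range (fun k => (l k : ℂ)) ∧
      ∀ k, Peakon.IsSimpleEigenvalue x m (l k : ℂ) := by
  refine ⟨Peakon.coeffA_eq_det x m hx, ?_⟩
  obtain ⟨l, hpos, hmono, hdet⟩ := Peakon.exists_factorization x m hx hm
  have hspec : Peakon.bvpSpectrum x m = Set.range (fun k => (l k : ℂ)) := by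
    ext z
    rw [Peakon.mem_bvpSpectrum_iff x m hm, hdet, Finset.prod_eq_zero_iff, Set.mem_range]
    refine ⟨fun ⟨k, _, hk⟩ => ⟨k, ?_⟩, fun ⟨k, hk⟩ => ⟨k, Finset.mem_univ k, ?_⟩⟩
    · have hl : (l k : ℂ) ≠ 0 := Complex.ofReal_ne_zero.2 (hpos k).ne'
      rw [sub_eq_zero, eq_div_iff hl, one_mul] at hk
      exact hk
    · have hl : (l k : ℂ) ≠ 0 := Complex.ofReal_ne_zero.2 (hpos k).ne'
      rw [← hk, div_self hl, sub_self]
  exact ⟨l, hpos, hmono, hdet, hspec, fun k =>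
    Peakon.isSimpleEigenvalue_of_mem_bvpSpectrum x m hx hm (hspec ▸ Set.mem_range_self k)⟩
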